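/- Let $(S_n)_{n\ge 0}$ be the integer sequence given by $S_0=0$, $S_1=1$ and $S_{n+1}=4S_n-S_{n-1}$ for $n\ge 1$. For every prime $p>3$, $$\sum_{k=0}^{(p-1)/2}\frac{\binom{3k}{k}\binom{6k}{3k}}{432^k}\equiv(-1)^{\frac{p-1}{2}}\left(1+\left(\frac{3}{p}\right)S_{p-\left(\frac{3}{p}\right)}\right)\pmod{p^2},$$ where $\left(\frac{3}{p}\right)$ is the Legendre symbol and the congruence is taken in the ring of rational numbers whose denominator is not divisible by $p$. -/

import Mathlib

/-- The integer sequence `S 0 = 0`, `S 1 = 1`, `S (n + 1) = 4 * S n - S (n - 1)` for `n ≥ 1`. -/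
def seqS : ℕ → ℤ
  | 0 => 0
  | 1 => 1
  | n + 2 => 4 * seqS (n + 1) - seqS n

/-- A rational number is `p`-integral if its (reduced) denominator is not divisible by `p`. -/
def PIntegral (p : ℕ) (x : ℚ) : Prop := ¬ p ∣ x.den

/-- Congruence modulo `p ^ n` in the ring of `p`-integral rational numbers: both sides are
`p`-integral and their difference is `p ^ n` times a `p`-integral rational number. -/
def RatCongr (p n : ℕ) (x y : ℚ) : Prop :=
  PIntegral p x ∧ PIntegral p y ∧ ∃ z : ℚ, PIntegral p z ∧ x - y = (p : ℚ) ^ n * z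

/-! The `k`-th summand equals C(a,k)·C(-1-a,k) for a = -1/6, and equally for a = -5/6. Put m =
(p-1)/2. Modulo p² one of these values is a = n + e with n = ⌊p/6⌋ and 6e = -p, so e² = 0. Let T(x)
be the sum of C(x,k)·C(-1-x,k) over k ≤ m.

Telescoping gives T(x+1) + T(x) = 2·C(x,m)·C(-2-x,m), and at x = j + e the right side collapses to
2e/(j+1) (`correction_mul_eq`). Starting from T(e) = 1 - e·H_m, with H_m the harmonic number, T(a)
is expressed through H_m and an alternating harmonic sum of length ⌊p/6⌋ (`truncSum_nat_add`).

Since C(p,k) ≡ (-1)^(k-1)·p/k mod p², these two sums become sums of C(p,2k) and of (-1)^j·C(p,6j).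
The former is a power of 2. The latter is evaluated by a filter over the sixth roots of -1, which
produces 2^m and a power of 2 + √3 (`six_mul_sum_choose_eq`). Frobenius in ℤ[√3] and the norm
equation turn that power into S at p - (3/p) (`pell_mod_prime_sq`). The powers of 2 cancel because
(2^m - (2/p))² ≡ 0 mod p². -/

/-- The falling factorial `x (x - 1) ⋯ (x - k + 1)`. -/
def fallingProd {R : Type*} [CommRing R] (x : R) (k : ℕ) : R :=
  ∏ i ∈ Finset.range k, (x - i)

/-- The truncated sum `∑_{k ≤ m} x^{\underline k} (-1 - x)^{\underline k} / k!²`, where `h k`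
plays the role of `1 / k!`. -/
def truncSum {R : Type*} [CommRing R] (h : ℕ → R) (m : ℕ) (x : R) : R :=
  ∑ k ∈ Finset.range (m + 1), h k ^ 2 * fallingProd x k * fallingProd (-1 - x) k

/-! ### The truncated sum at a nilpotent shift of a natural number -/

section Ring

variable {R : Type*} [CommRing R]

theorem fallingProd_zero (x : R) : fallingProd x 0 = 1 := by simp [fallingProd]

theorem fallingProd_succ (x : R) (k : ℕ) :
    fallingProd x (k + 1) = fallingProd x k * (x - k) := by
  simp [fallingProd, Finset.prod_range_succ]

theorem fallingProd_add_one_succ (x : R) (k : ℕ) :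
    fallingProd (x + 1) (k + 1) = (x + 1) * fallingProd x k := by
  rw [fallingProd, Finset.prod_range_succ', fallingProd, mul_comm]
  simp

theorem dvd_fallingProd_add {j m : ℕ} (h : j < m) (e : R) : e ∣ fallingProd (j + e) m := by
  have := Finset.dvd_prod_of_mem (fun i : ℕ => (j : R) + e - i) (Finset.mem_range.2 h)
  simpa [fallingProd] using this

/-- The sum telescopes: raising `m` by one adds on the left exactly the increment of the closed form
on the right. The recursion for `h` is required only up to `m`, since 1/k! exists modulo p² only for
k < p. -/
theorem truncSum_add_one_add (h : ℕ → R) (m : ℕ) (h0 : h 0 = 1)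
    (hs : ∀ k < m, h k = (k + 1) * h (k + 1)) (x : R) :
    truncSum h m (x + 1) + truncSum h m x =
      2 * (h m ^ 2 * fallingProd x m * fallingProd (-2 - x) m) := by
  induction m with
  | zero => simp [truncSum, fallingProd_zero, h0]; norm_num
  | succ m ih =>
    have ih' := ih fun k hk => hs k (by omega)
    have e1 : fallingProd (-1 - x) (m + 1) = (-1 - x) * fallingProd (-2 - x) m := by
      have := fallingProd_add_one_succ (-2 - x) m
      rwa [show -2 - x + 1 = -1 - x by ring] at this
    have hm := hs m (by omega)
    simp only [truncSum] at ih' ⊢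
    rw [Finset.sum_range_succ, Finset.sum_range_succ _ (m + 1), add_add_add_comm, ih', e1,
      show -1 - (x + 1) = -2 - x by ring, fallingProd_add_one_succ, fallingProd_succ x,
      fallingProd_succ (-2 - x), hm]
    ring

/-- To first order in `e`, C(e,k) is (-1)^(k-1)·e/k and C(-1-e,k) is (-1)^k, so each summand with k
> 0 is -e/k. -/
theorem summand_mul_eq (h : ℕ → R) (m : ℕ) (h0 : h 0 = 1)
    (hs : ∀ k < m, h k = (k + 1) * h (k + 1)) (hu : ∀ k, 0 < k → k ≤ m → IsUnit (k : R))
    (e : R) (he : e ^ 2 = 0) (k : ℕ) (hk : k + 1 ≤ m) :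
    ((k + 1 : ℕ) : R) * (h (k + 1) ^ 2 * fallingProd e (k + 1) * fallingProd (-1 - e) (k + 1))
      = -e := by
  induction k with
  | zero =>
    have h1 := hs 0 (by omega)
    simp only [h0, Nat.cast_zero, zero_add, one_mul] at h1
    simp [fallingProd_succ, fallingProd_zero, ← h1]
    linear_combination -he
  | succ k ih =>
    have ih' := ih (by omega)
    have hk1 := hs (k + 1) (by omega)
    have u := hu (k + 1 + 1) (by omega) hk
    apply u.mul_left_cancel
    obtain ⟨c, hc⟩ : e ∣ fallingProd e (k + 1) := by
      simpa using dvd_fallingProd_add (j := 0) (m := k + 1) (by omega) e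
    rw [fallingProd_succ e (k + 1), fallingProd_succ (-1 - e) (k + 1)]
    rw [hk1] at ih'
    rw [hc] at ih' ⊢
    push_cast at ih' ⊢
    linear_combination (k + 2 : R) * ih' - (h (k + 1 + 1) ^ 2 * c * fallingProd (-1 - e) (k + 1)) *
      (k + 2) ^ 2 * (e + 1) * he

theorem fallingProd_add_one_mul (x : R) (k : ℕ) :
    fallingProd (x + 1) k * (x + 1 - k) = (x + 1) * fallingProd x k := by
  rw [← fallingProd_succ, fallingProd_add_one_succ]

/-- For j < m the factor C(j+e,m) is divisible by `e`, so all else matters only modulo `e`. Passing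
from j to j+1 multiplies the product by (j+1)(j+2+m)/((j+2)(j+1-m)), and 2m+1 = 0 reduces this to
(j+1)/(j+2). This is where truncation at (p-1)/2 enters. -/
theorem correction_mul_eq (h : ℕ → R) (m : ℕ) (h0 : h 0 = 1)
    (hs : ∀ k < m, h k = (k + 1) * h (k + 1)) (hu : ∀ k, 0 < k → k ≤ m → IsUnit (k : R))
    (e : R) (he : e ^ 2 = 0) (hme : (2 * m + 1) * e = 0) (j : ℕ) (hj : j < m) :
    ((j + 1 : ℕ) : R) * (h m ^ 2 * fallingProd (j + e) m * fallingProd (-2 - (j + e)) m) = e := by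
  induction j with
  | zero =>
    obtain ⟨l, rfl⟩ : ∃ l, m = l + 1 := ⟨m - 1, by omega⟩
    have hsum := summand_mul_eq h (l + 1) h0 hs hu e he l le_rfl
    have hsh := fallingProd_add_one_mul (-2 - e) (l + 1)
    rw [show -2 - e + 1 = -1 - e by ring] at hsh
    obtain ⟨c, hc⟩ : e ∣ fallingProd e (l + 1) := by
      simpa using dvd_fallingProd_add (j := 0) hj e
    apply (hu (l + 1) (by omega) le_rfl).mul_left_cancel
    simp only [Nat.cast_zero, zero_add, Nat.cast_one, one_mul]
    rw [hc] at hsum ⊢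
    push_cast at hsum hsh hme ⊢
    -- Replacing -1-e by -2-e multiplies the last summand -e/m by m+1, which is -m against `e`.
    linear_combination (l + 2 : R) * hsum + h (l + 1) ^ 2 * c * (l + 1) * e * hsh +
      h (l + 1) ^ 2 * c * (l + 1) * (fallingProd (-1 - e) (l + 1) - fallingProd (-2 - e) (l + 1)) *
        he - hme
  | succ j ih =>
    have ih' := ih (by omega)
    have h1 := fallingProd_add_one_mul ((j : R) + e) m
    have h2 := fallingProd_add_one_mul (-2 - ((j + 1 : R) + e)) m
    rw [show -2 - ((j + 1 : R) + e) + 1 = -2 - (j + e) by ring] at h2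
    obtain ⟨c, hc⟩ : e ∣ fallingProd ((j : R) + e) m := dvd_fallingProd_add (by omega) e
    obtain ⟨d, hd⟩ : e ∣ fallingProd ((j : R) + 1 + e) m := by
      simpa using dvd_fallingProd_add (R := R) hj e
    rw [show (j : R) + e + 1 = j + 1 + e by ring] at h1
    have hu' : IsUnit ((m : R) - (j + 1)) := by
      have := hu (m - (j + 1)) (by omega) (by omega)
      rwa [Nat.cast_sub (by omega), Nat.cast_add, Nat.cast_one] at this
    apply hu'.mul_left_cancel
    push_cast at ih' ⊢
    rw [hc] at h1 ih'
    rw [hd] at h1 ⊢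
    linear_combination
      (h m ^ 2 * d * fallingProd (-2 - (j + 1 + e)) m * (2 * j + 3 - m + e) -
        h m ^ 2 * c * fallingProd (-2 - (j + e)) m * (2 * j + 3 + m + e)) * he -
      (2 + j + m) * ih' - hme -
      h m ^ 2 * (2 + j + e) * fallingProd (-2 - (j + 1 + e)) m * h1 -
      h m ^ 2 * (j + 1 + e) * (e * c) * h2

theorem truncSum_nat_add (h inv : ℕ → R) (m : ℕ) (h0 : h 0 = 1)
    (hs : ∀ k < m, h k = (k + 1) * h (k + 1)) (hu : ∀ k, 0 < k → k ≤ m → k * inv k = 1)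
    (e : R) (he : e ^ 2 = 0) (hme : (2 * m + 1) * e = 0) (n : ℕ) (hn : n ≤ m) :
    truncSum h m (n + e) = (-1) ^ n * (1 - e * ∑ k ∈ Finset.range m, inv (k + 1) +
      2 * e * ∑ k ∈ Finset.range n, (-1) ^ (k + 1) * inv (k + 1)) := by
  have hu' : ∀ k, 0 < k → k ≤ m → IsUnit (k : R) := fun k h1 h2 => IsUnit.of_mul_eq_one _ (hu k h1 h2)
  induction n with
  | zero =>
    rw [truncSum, Finset.sum_range_succ']
    have : ∀ k ∈ Finset.range m, h (k + 1) ^ 2 * fallingProd e (k + 1) *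
        fallingProd (-1 - e) (k + 1) = -e * inv (k + 1) := fun k hk => by
      have hk' := Finset.mem_range.1 hk
      have := summand_mul_eq h m h0 hs hu' e he k hk'
      linear_combination inv (k + 1) * this - (h (k + 1) ^ 2 * fallingProd e (k + 1) *
        fallingProd (-1 - e) (k + 1)) * hu (k + 1) (by omega) hk'
    simp only [Nat.cast_zero, zero_add, fallingProd_zero, h0]
    rw [Finset.sum_congr rfl this, ← Finset.mul_sum]
    simp
    ring
  | succ n ih =>
    have h1 := truncSum_add_one_add h m h0 hs ((n : R) + e)
    have h2 := correction_mul_eq h m h0 hs hu' e he hme n hn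
    have h3 := hu (n + 1) (by omega) hn
    rw [ih (by omega)] at h1
    rw [Finset.sum_range_succ _ n, show ((n + 1 : ℕ) : R) + e = n + e + 1 by push_cast; ring]
    have h4 : h m ^ 2 * fallingProd (n + e) m * fallingProd (-2 - (n + e)) m = e * inv (n + 1) := by
      linear_combination inv (n + 1) * h2 - (h m ^ 2 * fallingProd (n + e) m *
        fallingProd (-2 - (n + e)) m) * h3
    rw [h4] at h1
    have h5 : ((-1 : R) ^ n) * (-1) ^ n = 1 := by rw [← mul_pow]; simp
    rw [pow_succ]
    linear_combination h1 - 2 * e * inv (n + 1) * h5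

end Ring

/-! ### Powers of 2 + √3 and the Legendre symbol of 3 -/

/-- The coefficients of `(2 + √3) ^ k = X k + S k √3`. -/
def pellX : ℕ → ℤ
  | 0 => 1
  | k + 1 => 2 * pellX k + 3 * seqS k

theorem seqS_succ (k : ℕ) : seqS (k + 1) = pellX k + 2 * seqS k := by
  induction k with
  | zero => simp [seqS, pellX]
  | succ k ih => rw [seqS, pellX, ih]; ring

theorem pell_pow {R : Type*} [CommRing R] (s : R) (hs : s ^ 2 = 3) (k : ℕ) :
    (2 + s) ^ k = pellX k + seqS k * s := by
  induction k with
  | zero => simp [pellX, seqS]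
  | succ k ih =>
    rw [pow_succ, ih, seqS_succ, pellX]
    push_cast
    linear_combination (seqS k : R) * hs

theorem pellX_sq_sub (k : ℕ) : pellX k ^ 2 - 3 * seqS k ^ 2 = 1 := by
  induction k with
  | zero => simp [pellX, seqS]
  | succ k ih => rw [seqS_succ, pellX]; linear_combination ih

theorem pellX_eq_sub (k : ℕ) : pellX k = 2 * pellX (k + 1) - 3 * seqS (k + 1) := by
  rw [seqS_succ, pellX]; ring

theorem seqS_two_mul (k : ℕ) : seqS (2 * k) = 2 * pellX k * seqS k := by
  have h1 := pell_pow (R := ℤ√3) ⟨0, 1⟩ (by ext <;> simp [sq]) k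
  have h2 := pell_pow (R := ℤ√3) ⟨0, 1⟩ (by ext <;> simp [sq]) (2 * k)
  rw [mul_comm, pow_mul, h1] at h2
  have := congrArg Zsqrtd.im h2
  simp [sq] at this
  rw [mul_comm 2 k, ← this]; ring

theorem legendreSym_three_eq (p : ℕ) [Fact p.Prime] (hp : 3 < p) :
    legendreSym p 3 = if p % 12 = 1 ∨ p % 12 = 11 then 1 else -1 := by
  have : Fact (Nat.Prime 3) := ⟨Nat.prime_three⟩
  have hpp : p.Prime := Fact.out
  have h2 : p % 2 ≠ 0 := fun h => by
    have := (Nat.prime_dvd_prime_iff_eq Nat.prime_two hpp).1 (Nat.dvd_of_mod_eq_zero h); omega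
  have h3 : p % 3 ≠ 0 := fun h => by
    have := (Nat.prime_dvd_prime_iff_eq Nat.prime_three hpp).1 (Nat.dvd_of_mod_eq_zero h); omega
  have h := legendreSym.quadratic_reciprocity' (p := 3) (q := p) (by norm_num) (by omega)
  rw [legendreSym.mod 3 (p : ℤ)] at h
  have h12 : p % 12 = 1 ∨ p % 12 = 5 ∨ p % 12 = 7 ∨ p % 12 = 11 := by omega
  have e1 : @legendreSym 3 ⟨Nat.prime_three⟩ 1 = 1 := by decide
  have e2 : @legendreSym 3 ⟨Nat.prime_three⟩ 2 = -1 := by decide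
  rw [show ((3 : ℕ) : ℤ) = 3 from rfl, show 3 / 2 = 1 from rfl, one_mul] at h
  rcases h12 with c | c | c | c
  · rw [show (p : ℤ) % 3 = 1 by omega, e1, Even.neg_one_pow (Nat.even_iff.2 (by omega))] at h
    simp [h, c]
  · rw [show (p : ℤ) % 3 = 2 by omega, e2, Even.neg_one_pow (Nat.even_iff.2 (by omega))] at h
    simp [h, c]
  · rw [show (p : ℤ) % 3 = 1 by omega, e1, Odd.neg_one_pow (Nat.odd_iff.2 (by omega))] at h
    simp [h, c]
  · rw [show (p : ℤ) % 3 = 2 by omega, e2, Odd.neg_one_pow (Nat.odd_iff.2 (by omega))] at h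
    simp [h, c]

/-- Frobenius modulo p, used because (1 + √3)² = 2(2 + √3) makes 1 + √3 a square root of 2 + √3 up
to the factor 2. -/
theorem exists_one_add_sqrt_three_pow (p : ℕ) [Fact p.Prime] (m : ℕ) (hm : p = 2 * m + 1) :
    ∃ r : ℤ√3, (1 + ⟨0, 1⟩ : ℤ√3) ^ p = 1 + (3 : ℤ√3) ^ m * ⟨0, 1⟩ + p * r := by
  obtain ⟨r, hr⟩ := exists_add_pow_prime_eq (Fact.out : p.Prime) (1 : ℤ√3) ⟨0, 1⟩
  refine ⟨1 * ⟨0, 1⟩ * r, hr.trans ?_⟩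
  have : (⟨0, 1⟩ : ℤ√3) ^ p = 3 ^ m * ⟨0, 1⟩ := by
    rw [hm, pow_succ, pow_mul, show (⟨0, 1⟩ : ℤ√3) ^ 2 = 3 by ext <;> simp [sq]]
  rw [one_pow, this]
  ring

/-! ### Binomial coefficients C(p,k) modulo p² -/

theorem sum_range_choose_two_mul (n t : ℕ) :
    ∑ k ∈ Finset.range (t + 1), (n + 1).choose (2 * k) =
      ∑ i ∈ Finset.range (2 * t + 1), n.choose i := by
  induction t with
  | zero => simp
  | succ t ih =>
    rw [Finset.sum_range_succ, ih, show 2 * (t + 1) + 1 = 2 * t + 1 + 1 + 1 by ring,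
      Finset.sum_range_succ _ (2 * t + 1 + 1), Finset.sum_range_succ _ (2 * t + 1),
      show 2 * (t + 1) = 2 * t + 1 + 1 by ring, Nat.choose_succ_succ]
    ring

theorem natCast_choose_sub_one (p : ℕ) [Fact p.Prime] (k : ℕ) (hk : k < p) :
    (((p - 1).choose k : ℕ) : ZMod p) = (-1) ^ k := by
  have hp : p.Prime := Fact.out
  induction k with
  | zero => simp
  | succ k ih =>
    have h1 : p.choose (k + 1) = (p - 1).choose k + (p - 1).choose (k + 1) := by
      rw [← Nat.choose_succ_succ, Nat.succ_eq_add_one, Nat.sub_add_cancel hp.one_le]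
    have h2 := (ZMod.natCast_eq_zero_iff (p.choose (k + 1)) p).2
      (hp.dvd_choose_self (by omega) hk)
    rw [h1, Nat.cast_add, ih (by omega)] at h2
    rw [pow_succ]
    linear_combination h2

/-- In k·C(p,k) = p·C(p-1,k-1) the right-hand binomial matters only modulo p, where it is a sign. -/
theorem natCast_mul_choose (p : ℕ) [Fact p.Prime] (k : ℕ) (hk : k + 1 < p) :
    ((k + 1 : ℕ) : ZMod (p ^ 2)) * p.choose (k + 1) = (-1) ^ k * p := by
  have hp : 0 < p := by omega
  have h1 : (k + 1) * p.choose (k + 1) = p * (p - 1).choose k := by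
    have := Nat.add_one_mul_choose_eq (p - 1) k
    rw [Nat.sub_add_cancel hp] at this
    rw [this]; ring
  have h3 : (p : ℤ) ∣ (p - 1).choose k - (-1) ^ k := by
    rw [← ZMod.intCast_zmod_eq_zero_iff_dvd _ p]
    push_cast
    rw [natCast_choose_sub_one p k (by omega), sub_self]
  obtain ⟨c, hc⟩ := h3
  have h4 := congrArg (Nat.cast : ℕ → ZMod (p ^ 2)) h1
  have h5 := congrArg (Int.cast : ℤ → ZMod (p ^ 2)) hc
  have h6 : (p : ZMod (p ^ 2)) ^ 2 = 0 := by exact_mod_cast ZMod.natCast_self (p ^ 2)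
  push_cast at h4 h5 ⊢
  linear_combination h4 + p * h5 + c * h6

/-! ### Pell coefficients modulo p and p² -/

/-- The power `(2 + √3) ^ ((p - (3/p)) / 2)` modulo `p`, up to the factor `2 ^ ((p - 1) / 2)`. -/
theorem pell_mod_prime (p : ℕ) [Fact p.Prime] (hp : 3 < p) (m M : ℕ) (hm : p = 2 * m + 1)
    (hM : (2 * M : ℤ) = p - legendreSym p 3) :
    ((2 ^ m * pellX M : ℤ) : ZMod p) = legendreSym p 3 ∧ ((seqS M : ℤ) : ZMod p) = 0 := by
  obtain ⟨r, hr⟩ := exists_one_add_sqrt_three_pow p m hm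
  have h2 : (2 : ZMod p) ≠ 0 := fun h => by
    have := Nat.le_of_dvd (by norm_num) ((ZMod.natCast_eq_zero_iff 2 p).1 (by exact_mod_cast h))
    omega
  have hpow := pell_pow (R := ℤ√3) ⟨0, 1⟩ (by ext <;> simp [sq]) M
  have hsq : (1 + ⟨0, 1⟩ : ℤ√3) ^ (2 * M) = 2 ^ M * (pellX M + seqS M * ⟨0, 1⟩) := by
    rw [← hpow, pow_mul, ← mul_pow]
    congr 1
  have hcast : (3 : ZMod p) ^ m = legendreSym p 3 := by
    rw [legendreSym.eq_pow, show p / 2 = m by omega]; norm_num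
  have h3 := legendreSym_three_eq p hp
  have h3m : ∃ c : ℤ, (3 : ℤ) ^ m = legendreSym p 3 + p * c := by
    have : (p : ℤ) ∣ 3 ^ m - legendreSym p 3 := by
      rw [← ZMod.intCast_zmod_eq_zero_iff_dvd _ p]
      push_cast
      rw [hcast, sub_self]
    obtain ⟨c, hc⟩ := this
    exact ⟨c, by linarith⟩
  obtain ⟨c, hc⟩ := h3m
  have hc' : (3 : ℤ√3) ^ m = legendreSym p 3 + p * c := by exact_mod_cast congrArg (Int.cast : ℤ → ℤ√3) hc
  rw [hc'] at hr
  have hs : (⟨0, 1⟩ : ℤ√3) ^ 2 = 3 := by ext <;> simp [sq]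
  have key : ∃ r' : ℤ√3, 2 ^ (m + 1) * (pellX M + seqS M * ⟨0, 1⟩ : ℤ√3) =
      2 * legendreSym p 3 + p * r' := by
    split_ifs at h3 with h
    · rw [h3] at hM hr ⊢
      have hMm : M = m := by omega
      rw [hm, pow_succ, ← hMm, hsq, hMm] at hr
      -- Here 2M = p - 1, so one factor 1 + √3 has to be removed: multiplying by √3 - 1 turns it
      -- into 2.
      refine ⟨(c * ⟨0, 1⟩ + r) * (⟨0, 1⟩ - 1), ?_⟩
      rw [hMm, hm]
      push_cast at hr ⊢
      linear_combination (⟨0, 1⟩ - 1 : ℤ√3) * hr - (2 ^ m * (pellX m + seqS m * ⟨0, 1⟩) - 1 : ℤ√3) * hs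
    · rw [h3] at hM hr ⊢
      have hMm : M = m + 1 := by omega
      have h1 : (1 + ⟨0, 1⟩ : ℤ√3) ^ (2 * M) = (1 + ⟨0, 1⟩) ^ p * (1 + ⟨0, 1⟩) := by
        rw [hMm, hm]; ring
      rw [hsq, hr, hMm] at h1
      refine ⟨(c * ⟨0, 1⟩ + r) * (1 + ⟨0, 1⟩), ?_⟩
      rw [hMm]
      push_cast at h1 ⊢
      linear_combination h1 - hs
  obtain ⟨r', hr'⟩ := key
  rw [show (2 : ℤ√3) ^ (m + 1) * (pellX M + seqS M * ⟨0, 1⟩) =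
    ((2 ^ (m + 1) : ℤ) : ℤ√3) * ⟨pellX M, seqS M⟩ by
      push_cast; congr 1; ext <;> simp,
    show 2 * (legendreSym p 3 : ℤ√3) + p * r' =
      ((2 * legendreSym p 3 : ℤ) : ℤ√3) + ((p : ℤ) : ℤ√3) * r' by push_cast; rfl] at hr'
  have hre := congrArg (Int.cast : ℤ → ZMod p) (congrArg Zsqrtd.re hr')
  have him := congrArg (Int.cast : ℤ → ZMod p) (congrArg Zsqrtd.im hr')
  simp only [Zsqrtd.re_add, Zsqrtd.im_add, Zsqrtd.re_intCast, Zsqrtd.im_intCast, Zsqrtd.re_smul,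
    Zsqrtd.im_smul] at hre him
  push_cast at hre him
  simp only [CharP.cast_eq_zero (ZMod p) p] at hre him
  constructor
  · apply mul_left_cancel₀ h2
    push_cast
    linear_combination hre
  · simpa [h2] using him

/-- The value of `pellX` at `(p + (3/p)) / 2` modulo `p ^ 2`, in terms of `seqS` at `p - (3/p)`. -/
theorem pell_mod_prime_sq (p : ℕ) [Fact p.Prime] (hp : 3 < p) (m M N : ℕ) (hm : p = 2 * m + 1)
    (hM : (2 * M : ℤ) = p - legendreSym p 3) (hN : (2 * N : ℤ) = p + legendreSym p 3) :
    ((2 * legendreSym p 2 * legendreSym p 3 * pellX N : ℤ) : ZMod (p ^ 2)) =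
      ((4 + 3 * legendreSym p 3 * seqS (2 * M) : ℤ) : ZMod (p ^ 2)) := by
  obtain ⟨hX, hS⟩ := pell_mod_prime p hp m M hm hM
  have h20 : ((2 : ℤ) : ZMod p) ≠ 0 := fun h => by
    have := Nat.le_of_dvd (by norm_num) ((ZMod.natCast_eq_zero_iff 2 p).1 (by exact_mod_cast h))
    omega
  have h30 : ((3 : ℤ) : ZMod p) ≠ 0 := fun h => by
    have := Nat.le_of_dvd (by norm_num) ((ZMod.natCast_eq_zero_iff 3 p).1 (by exact_mod_cast h))
    omega
  have h2m : (2 : ZMod p) ^ m = legendreSym p 2 := by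
    rw [legendreSym.eq_pow, show p / 2 = m by omega]; norm_num
  have hd := legendreSym.sq_one p h30
  have he := legendreSym.sq_one p h20
  have hXN : pellX N = 2 * pellX M + 3 * legendreSym p 3 * seqS M := by
    rcases legendreSym.eq_one_or_neg_one p h30 with h | h
    · rw [h] at hM hN ⊢
      rw [show N = M + 1 by omega, pellX]; ring
    · rw [h] at hM hN ⊢
      rw [show M = N + 1 by omega, pellX_eq_sub N]; ring
  generalize legendreSym p 3 = d at *
  generalize legendreSym p 2 = e at *
  have he' := congrArg (Int.cast : ℤ → ZMod p) he
  have hX' : (p : ℤ) ∣ pellX M - e * d := by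
    rw [← ZMod.intCast_zmod_eq_zero_iff_dvd _ p]
    push_cast at hX he' ⊢
    linear_combination e * hX - e * pellX M * h2m - pellX M * he'
  obtain ⟨a, ha⟩ := hX'
  obtain ⟨b, hb⟩ := (ZMod.intCast_zmod_eq_zero_iff_dvd _ p).1 hS
  have hp2 : (p : ZMod (p ^ 2)) ^ 2 = 0 := by exact_mod_cast ZMod.natCast_self (p ^ 2)
  have hnorm := congrArg (Int.cast : ℤ → ZMod (p ^ 2)) (pellX_sq_sub M)
  have hmm := congrArg (Nat.cast : ℕ → ZMod (p ^ 2)) hm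
  replace ha := congrArg (Int.cast : ℤ → ZMod (p ^ 2)) ha
  replace hb := congrArg (Int.cast : ℤ → ZMod (p ^ 2)) hb
  replace hd := congrArg (Int.cast : ℤ → ZMod (p ^ 2)) hd
  replace he := congrArg (Int.cast : ℤ → ZMod (p ^ 2)) he
  rw [hXN, seqS_two_mul]
  push_cast at *
  have hX2 : (pellX M : ZMod (p ^ 2)) = e * d + p * a := by linear_combination ha
  rw [hb, hX2] at hnorm
  -- As p divides S_M, the norm equation gives X_M² ≡ 1 mod p². Hence the first-order deviation of
  -- X_M from the sign e·d vanishes, and X_M is known modulo p².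
  have h2 : (2 : ZMod (p ^ 2)) * (e * d * (p * a)) = 0 := by
    linear_combination hnorm - a ^ 2 * hp2 + 3 * b ^ 2 * hp2 - d ^ 2 * he - hd
  rw [hb, hX2]
  linear_combination 2 * h2 + 4 * d ^ 2 * he + 4 * hd -
    6 * d * a * b * hp2

/-! ### The sum of (-1)^j·C(p,6j) by roots of unity -/

theorem exists_complex_root_twentyfour : ∃ η : ℂ, η ^ 8 = η ^ 4 - 1 := by
  obtain ⟨ω, hω⟩ := IsAlgClosed.exists_pow_nat_eq
    (Complex.exp (2 * Real.pi * Complex.I / (6 : ℕ))) (n := 4) (by norm_num)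
  refine ⟨ω, ?_⟩
  have h := (Complex.isPrimitiveRoot_exp 6 (by norm_num)).isRoot_cyclotomic (by norm_num)
  rw [← hω, Polynomial.cyclotomic_six] at h
  simp at h
  linear_combination h

/-- With ζ a primitive 12th root of unity, the numbers ±ζ, ±ζ³, ±ζ⁵ are the six roots of z⁶ = -1.
Their k-th power sum isolates the multiples of 6 and supplies the sign (-1)^(k/6). -/
theorem sum_odd_powers_eq {K : Type*} [CommRing K] (ζ : K) (hζ : ζ ^ 4 = ζ ^ 2 - 1) (k : ℕ) :
    (1 + (-1) ^ k) * (ζ ^ k + ζ ^ (3 * k) + ζ ^ (5 * k)) =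
      if 6 ∣ k then 6 * (-1) ^ (k / 6) else 0 := by
  have h6 : ζ ^ 6 = -1 := by linear_combination (ζ ^ 2 + 1) * hζ
  obtain ⟨q, r, hr, rfl⟩ : ∃ q r, r < 6 ∧ k = 6 * q + r :=
    ⟨k / 6, k % 6, Nat.mod_lt _ (by norm_num), by omega⟩
  have e (j : ℕ) (hj : (-1 : K) ^ j = -1) : ζ ^ (j * (6 * q + r)) = (-1) ^ q * ζ ^ (j * r) := by
    rw [show j * (6 * q + r) = 6 * (j * q) + j * r by ring, pow_add, pow_mul, h6, pow_mul (-1) j, hj]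
  have e1 := e 1 (by norm_num)
  have e3 := e 3 (by norm_num)
  have e5 := e 5 (by norm_num)
  rw [one_mul, one_mul] at e1
  rw [e1, e3, e5, pow_add, pow_mul, show (-1 : K) ^ 6 = 1 by norm_num, one_pow, one_mul]
  interval_cases r
  · simp; ring
  · simp; omega
  · rw [if_neg (by omega)]
    linear_combination 2 * (-1) ^ q * ((1 + ζ ^ 4) * h6 - hζ)
  · rw [if_neg (by omega)]; norm_num
  · rw [if_neg (by omega)]
    linear_combination 2 * (-1) ^ q *
      ((ζ ^ 6 - 1) * h6 + ζ ^ 2 * (ζ ^ 12 - ζ ^ 6 + 1) * h6 + hζ)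
  · rw [if_neg (by omega)]; norm_num

theorem six_mul_sum_choose {K : Type*} [CommRing K] (ζ : K) (hζ : ζ ^ 4 = ζ ^ 2 - 1) (p : ℕ) :
    (6 * ∑ j ∈ Finset.range (p / 6 + 1), (-1) ^ j * (p.choose (6 * j) : K)) =
      (1 + ζ) ^ p + (1 - ζ) ^ p + ((1 + ζ ^ 3) ^ p + (1 - ζ ^ 3) ^ p) +
        ((1 + ζ ^ 5) ^ p + (1 - ζ ^ 5) ^ p) := by
  have expand (z : K) : (1 + z) ^ p + (1 - z) ^ p =
      ∑ k ∈ Finset.range (p + 1), (1 + (-1) ^ k) * z ^ k * p.choose k := by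
    rw [add_comm 1 z, sub_eq_add_neg, add_comm 1 (-z), add_pow, add_pow, ← Finset.sum_add_distrib]
    refine Finset.sum_congr rfl fun k _ => ?_
    rw [neg_pow z]; simp; ring
  rw [expand, expand, expand, ← Finset.sum_add_distrib, ← Finset.sum_add_distrib]
  have : ∀ k ∈ Finset.range (p + 1), (1 + (-1) ^ k) * ζ ^ k * p.choose k +
      (1 + (-1) ^ k) * (ζ ^ 3) ^ k * p.choose k + (1 + (-1) ^ k) * (ζ ^ 5) ^ k * p.choose k =
      if 6 ∣ k then 6 * (-1) ^ (k / 6) * (p.choose k : K) else 0 := fun k _ => by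
    rw [← ite_zero_mul, ← sum_odd_powers_eq ζ hζ, pow_mul, pow_mul]; ring
  rw [Finset.sum_congr rfl this, ← Finset.sum_filter, Finset.mul_sum]
  refine Finset.sum_bij (fun j _ => 6 * j) ?_ ?_ ?_ ?_
  · intro j hj
    simp only [Finset.mem_range, Finset.mem_filter] at hj ⊢
    exact ⟨by omega, by simp⟩
  · intro i _ j _ h; exact Nat.eq_of_mul_eq_mul_left (by norm_num) h
  · intro k hk
    simp only [Finset.mem_range, Finset.mem_filter] at hk ⊢
    exact ⟨k / 6, by omega, by omega⟩
  · intro j _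
    simp; ring

/-- For a 24th root of unity η with ζ = η², each 1 ± ζ^i is a power of η times η + η⁻¹, η⁵ + η⁻⁵ or
η³ + η⁻³, whose squares are 2 + √3, 2 - √3 and 2. The p-th powers of the η factors depend only on p
mod 24, and combine in pairs to these same three numbers up to sign. -/
theorem six_mul_sum_choose_eq (p : ℕ) [Fact p.Prime] (hp : 3 < p) (m N : ℕ) (hm : p = 2 * m + 1)
    (hN : (2 * N : ℤ) = p + legendreSym p 3) :
    6 * ∑ j ∈ Finset.range (p / 6 + 1), (-1) ^ j * (p.choose (6 * j) : ℤ) =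
      2 * legendreSym p 2 * 2 ^ m + 2 * legendreSym p 2 * legendreSym p 3 * pellX N := by
  obtain ⟨η, hη⟩ := exists_complex_root_twentyfour
  have h12 : η ^ 12 = -1 := by linear_combination (η ^ 4 + 1) * hη
  have h24 : η ^ 24 = 1 := by linear_combination (η ^ 12 - 1) * h12
  -- η² - η¹⁰ = ζ + ζ⁻¹ plays the role of √3.
  have hs : (η ^ 2 - η ^ 10) ^ 2 = 3 := by
    linear_combination (η ^ 8 - 2) * h12 - hη
  have hsum := six_mul_sum_choose (η ^ 2) (by linear_combination hη) p
  have hpow (r : ℕ) : (η ^ r) ^ p = η ^ (r * p % 24) := by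
    rw [← pow_mul]
    conv_lhs => rw [← Nat.div_add_mod (r * p) 24]
    rw [pow_add, pow_mul, h24, one_pow, one_mul]
  have f1 : (1 + η ^ 2) ^ p = (η ^ 1) ^ p * (η - η ^ 11) ^ p := by
    rw [← mul_pow]; congr 1; linear_combination h12
  have f2 : (1 - (η ^ 2) ^ 5) ^ p = (η ^ 23) ^ p * (η - η ^ 11) ^ p := by
    rw [← mul_pow]; congr 1; linear_combination (η ^ 22 - η ^ 10 - η ^ 12 + 1) * h12
  have f3 : (1 + (η ^ 2) ^ 5) ^ p = (η ^ 5) ^ p * (η ^ 5 - η ^ 7) ^ p := by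
    rw [← mul_pow]; congr 1; linear_combination h12
  have f4 : (1 - η ^ 2) ^ p = (η ^ 19) ^ p * (η ^ 5 - η ^ 7) ^ p := by
    rw [← mul_pow]; congr 1; linear_combination (η ^ 2 * (η ^ 12 - 1) - (η ^ 12 - 1)) * h12
  have f5 : (1 + (η ^ 2) ^ 3) ^ p = (η ^ 3) ^ p * (η ^ 3 - η ^ 9) ^ p := by
    rw [← mul_pow]; congr 1; linear_combination h12
  have f6 : (1 - (η ^ 2) ^ 3) ^ p = (η ^ 21) ^ p * (η ^ 3 - η ^ 9) ^ p := by
    rw [← mul_pow]; congr 1; linear_combination (η ^ 6 * (η ^ 12 - 1) - (η ^ 12 - 1)) * h12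
  rw [f1, f2, f3, f4, f5, f6] at hsum
  simp only [hpow, one_mul] at hsum
  have huu : (η - η ^ 11) * (η - η ^ 11) = 2 + (η ^ 2 - η ^ 10) := by
    linear_combination (η ^ 10 - 2) * h12
  have hvv : (η ^ 5 - η ^ 7) * (η ^ 5 - η ^ 7) = 2 + -(η ^ 2 - η ^ 10) := by
    linear_combination (η ^ 2 - 2) * h12
  have huv : (η - η ^ 11) * (η ^ 5 - η ^ 7) = 1 := by
    linear_combination (η ^ 6 - η ^ 4) * h12 - hη
  have hww : (η ^ 3 - η ^ 9) * (η ^ 3 - η ^ 9) = 2 := by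
    linear_combination (η ^ 6 - 2) * h12
  have hpowp (z : ℂ) : z ^ p = z * (z * z) ^ m := by rw [hm]; ring
  rw [hpowp (η - η ^ 11), hpowp (η ^ 5 - η ^ 7), hpowp (η ^ 3 - η ^ 9), huu, hvv, hww] at hsum
  have hX := pell_pow _ hs N
  have hX' := pell_pow _ ((neg_sq (η ^ 2 - η ^ 10)).trans hs) N
  -- p ≡ ±1 mod 12: the pairs for u = η - η¹¹ and v = η⁵ - η⁷ return ±u and ±v, and the extra u² or
  -- v² raises the exponent to m + 1.
  have case_pos (a b : ℂ) (h1 : η ^ (p % 24) + η ^ (23 * p % 24) = a * (η - η ^ 11))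
      (h5 : η ^ (5 * p % 24) + η ^ (19 * p % 24) = a * (η ^ 5 - η ^ 7))
      (h3 : η ^ (3 * p % 24) + η ^ (21 * p % 24) = b * (η ^ 3 - η ^ 9)) (hNm : N = m + 1) :
      6 * ∑ j ∈ Finset.range (p / 6 + 1), (-1) ^ j * (p.choose (6 * j) : ℂ) =
        2 * b * 2 ^ m + 2 * a * pellX N := by
    rw [hNm] at hX hX' ⊢
    linear_combination hsum + (η - η ^ 11) * (2 + (η ^ 2 - η ^ 10)) ^ m * h1 +
      (η ^ 5 - η ^ 7) * (2 + -(η ^ 2 - η ^ 10)) ^ m * h5 + (η ^ 3 - η ^ 9) * 2 ^ m * h3 +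
      a * (2 + (η ^ 2 - η ^ 10)) ^ m * huu + a * (2 + -(η ^ 2 - η ^ 10)) ^ m * hvv +
      b * 2 ^ m * hww + a * hX + a * hX'
  -- p ≡ ±5 mod 12: the pairs are interchanged, and uv = 1 leaves the exponent m.
  have case_neg (a b : ℂ) (h1 : η ^ (p % 24) + η ^ (23 * p % 24) = a * (η ^ 5 - η ^ 7))
      (h5 : η ^ (5 * p % 24) + η ^ (19 * p % 24) = a * (η - η ^ 11))
      (h3 : η ^ (3 * p % 24) + η ^ (21 * p % 24) = b * (η ^ 3 - η ^ 9)) (hNm : N = m) :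
      6 * ∑ j ∈ Finset.range (p / 6 + 1), (-1) ^ j * (p.choose (6 * j) : ℂ) =
        2 * b * 2 ^ m + 2 * a * pellX N := by
    rw [hNm] at hX hX' ⊢
    linear_combination hsum + (η - η ^ 11) * (2 + (η ^ 2 - η ^ 10)) ^ m * h1 +
      (η ^ 5 - η ^ 7) * (2 + -(η ^ 2 - η ^ 10)) ^ m * h5 + (η ^ 3 - η ^ 9) * 2 ^ m * h3 +
      a * (2 + (η ^ 2 - η ^ 10)) ^ m * huv + a * (2 + -(η ^ 2 - η ^ 10)) ^ m * huv +
      b * 2 ^ m * hww + a * hX + a * hX'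
  have h3 := legendreSym_three_eq p hp
  have h2 := (legendreSym.at_two (p := p) (by omega)).trans (ZMod.χ₈_nat_eq_if_mod_eight p)
  have hpp : p.Prime := Fact.out
  have hp3 : p % 3 ≠ 0 := fun h => by
    have := (Nat.prime_dvd_prime_iff_eq Nat.prime_three hpp).1 (Nat.dvd_of_mod_eq_zero h); omega
  have hcases : p % 24 = 1 ∨ p % 24 = 5 ∨ p % 24 = 7 ∨ p % 24 = 11 ∨ p % 24 = 13 ∨ p % 24 = 17 ∨
      p % 24 = 19 ∨ p % 24 = 23 := by omega
  rify
  apply Complex.ofReal_injective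
  push_cast
  rcases hcases with c | c | c | c | c | c | c | c
  · rw [if_pos (by omega)] at h3
    rw [if_neg (by omega), if_pos (by omega)] at h2
    rw [h3] at hN
    rw [h2, h3, case_pos (1) (1) ?_ ?_ ?_ (by omega)]
    · push_cast; ring
    · rw [c, show 23 * p % 24 = 23 by omega]
      linear_combination η ^ 11 * h12
    · rw [show 5 * p % 24 = 5 by omega, show 19 * p % 24 = 19 by omega]
      linear_combination η ^ 7 * h12
    · rw [show 3 * p % 24 = 3 by omega, show 21 * p % 24 = 21 by omega]
      linear_combination η ^ 9 * h12
  · rw [if_neg (by omega)] at h3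
    rw [if_neg (by omega), if_neg (by omega)] at h2
    rw [h3] at hN
    rw [h2, h3, case_neg (1) (-1) ?_ ?_ ?_ (by omega)]
    · push_cast; ring
    · rw [c, show 23 * p % 24 = 19 by omega]
      linear_combination η ^ 7 * h12
    · rw [show 5 * p % 24 = 1 by omega, show 19 * p % 24 = 23 by omega]
      linear_combination η ^ 11 * h12
    · rw [show 3 * p % 24 = 15 by omega, show 21 * p % 24 = 9 by omega]
      linear_combination η ^ 3 * h12
  · rw [if_neg (by omega)] at h3
    rw [if_neg (by omega), if_pos (by omega)] at h2
    rw [h3] at hN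
    rw [h2, h3, case_neg (-1) (1) ?_ ?_ ?_ (by omega)]
    · push_cast; ring
    · rw [c, show 23 * p % 24 = 17 by omega]
      linear_combination η ^ 5 * h12
    · rw [show 5 * p % 24 = 11 by omega, show 19 * p % 24 = 13 by omega]
      linear_combination η ^ 1 * h12
    · rw [show 3 * p % 24 = 21 by omega, show 21 * p % 24 = 3 by omega]
      linear_combination η ^ 9 * h12
  · rw [if_pos (by omega)] at h3
    rw [if_neg (by omega), if_neg (by omega)] at h2
    rw [h3] at hN
    rw [h2, h3, case_pos (-1) (-1) ?_ ?_ ?_ (by omega)]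
    · push_cast; ring
    · rw [c, show 23 * p % 24 = 13 by omega]
      linear_combination η ^ 1 * h12
    · rw [show 5 * p % 24 = 7 by omega, show 19 * p % 24 = 17 by omega]
      linear_combination η ^ 5 * h12
    · rw [show 3 * p % 24 = 9 by omega, show 21 * p % 24 = 15 by omega]
      linear_combination η ^ 3 * h12
  · rw [if_pos (by omega)] at h3
    rw [if_neg (by omega), if_neg (by omega)] at h2
    rw [h3] at hN
    rw [h2, h3, case_pos (-1) (-1) ?_ ?_ ?_ (by omega)]
    · push_cast; ring
    · rw [c, show 23 * p % 24 = 11 by omega]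
      linear_combination η ^ 1 * h12
    · rw [show 5 * p % 24 = 17 by omega, show 19 * p % 24 = 7 by omega]
      linear_combination η ^ 5 * h12
    · rw [show 3 * p % 24 = 15 by omega, show 21 * p % 24 = 9 by omega]
      linear_combination η ^ 3 * h12
  · rw [if_neg (by omega)] at h3
    rw [if_neg (by omega), if_pos (by omega)] at h2
    rw [h3] at hN
    rw [h2, h3, case_neg (-1) (1) ?_ ?_ ?_ (by omega)]
    · push_cast; ring
    · rw [c, show 23 * p % 24 = 7 by omega]
      linear_combination η ^ 5 * h12
    · rw [show 5 * p % 24 = 13 by omega, show 19 * p % 24 = 11 by omega]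
      linear_combination η ^ 1 * h12
    · rw [show 3 * p % 24 = 3 by omega, show 21 * p % 24 = 21 by omega]
      linear_combination η ^ 9 * h12
  · rw [if_neg (by omega)] at h3
    rw [if_neg (by omega), if_neg (by omega)] at h2
    rw [h3] at hN
    rw [h2, h3, case_neg (1) (-1) ?_ ?_ ?_ (by omega)]
    · push_cast; ring
    · rw [c, show 23 * p % 24 = 5 by omega]
      linear_combination η ^ 7 * h12
    · rw [show 5 * p % 24 = 23 by omega, show 19 * p % 24 = 1 by omega]
      linear_combination η ^ 11 * h12
    · rw [show 3 * p % 24 = 9 by omega, show 21 * p % 24 = 15 by omega]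
      linear_combination η ^ 3 * h12
  · rw [if_pos (by omega)] at h3
    rw [if_neg (by omega), if_pos (by omega)] at h2
    rw [h3] at hN
    rw [h2, h3, case_pos (1) (1) ?_ ?_ ?_ (by omega)]
    · push_cast; ring
    · rw [c, show 23 * p % 24 = 1 by omega]
      linear_combination η ^ 11 * h12
    · rw [show 5 * p % 24 = 19 by omega, show 19 * p % 24 = 5 by omega]
      linear_combination η ^ 7 * h12
    · rw [show 3 * p % 24 = 21 by omega, show 21 * p % 24 = 3 by omega]
      linear_combination η ^ 9 * h12

/-! ### Harmonic sums and evaluation of the truncated sum modulo p² -/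

theorem natCast_mul_inv_eq_one (p : ℕ) [Fact p.Prime] (k : ℕ) (h0 : 0 < k) (hk : k < p) :
    (k : ZMod (p ^ 2)) * (k : ZMod (p ^ 2))⁻¹ = 1 :=
  ZMod.coe_mul_inv_eq_one k (Nat.Coprime.pow_right 2
    (((Nat.Prime.coprime_iff_not_dvd Fact.out).2 (Nat.not_dvd_of_pos_of_lt h0 hk)).symm))

theorem natCast_prime_sq_eq_zero (p : ℕ) : (p : ZMod (p ^ 2)) ^ 2 = 0 := by
  exact_mod_cast ZMod.natCast_self (p ^ 2)

/-- Each p/k is -2·C(p,2k), and the even-index binomials of p add up to 2^(p-1). -/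
theorem prime_mul_inv_sum (p : ℕ) [Fact p.Prime] (m : ℕ) (hm : p = 2 * m + 1) :
    (p : ZMod (p ^ 2)) * ∑ k ∈ Finset.range m, ((k + 1 : ℕ) : ZMod (p ^ 2))⁻¹ =
      -2 * ((2 ^ m) ^ 2 - 1) := by
  have h := congrArg (Nat.cast : ℕ → ZMod (p ^ 2)) (sum_range_choose_two_mul (2 * m) m)
  rw [Nat.sum_range_choose, Finset.sum_range_succ', ← hm] at h
  push_cast at h
  rw [mul_comm 2 m, pow_mul, Nat.choose_zero_right, Nat.cast_one] at h
  rw [← h, add_sub_cancel_right, Finset.mul_sum, Finset.mul_sum]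
  refine Finset.sum_congr rfl fun k hk => ?_
  have hk := Finset.mem_range.1 hk
  have h1 := natCast_mul_inv_eq_one p (k + 1) (by omega) (by omega)
  have h2 := natCast_mul_choose p (2 * k + 1) (by omega)
  rw [Odd.neg_one_pow ⟨k, rfl⟩, show 2 * k + 1 + 1 = 2 * (k + 1) by ring] at h2
  push_cast at h1 h2 ⊢
  linear_combination ((k : ZMod (p ^ 2)) + 1)⁻¹ * h2 -
    2 * (p.choose (2 * (k + 1)) : ZMod (p ^ 2)) * h1

/-- Here p/k is rewritten as -6·C(p,6k), valid because 6k < p throughout. -/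
theorem prime_mul_alternating_inv_sum (p : ℕ) [Fact p.Prime] :
    (p : ZMod (p ^ 2)) *
        ∑ k ∈ Finset.range (p / 6), (-1) ^ (k + 1) * ((k + 1 : ℕ) : ZMod (p ^ 2))⁻¹ =
      6 - 6 * ∑ j ∈ Finset.range (p / 6 + 1), (-1) ^ j * (p.choose (6 * j) : ZMod (p ^ 2)) := by
  have hp : p.Prime := Fact.out
  have h6 : p ≠ 6 * (p / 6) := fun h => by
    have := (Nat.prime_dvd_prime_iff_eq Nat.prime_two hp).1 ⟨3 * (p / 6), by omega⟩
    omega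
  rw [Finset.sum_range_succ', Finset.mul_sum]
  have : ∀ k ∈ Finset.range (p / 6), (p : ZMod (p ^ 2)) *
      ((-1) ^ (k + 1) * ((k + 1 : ℕ) : ZMod (p ^ 2))⁻¹) =
      -6 * ((-1) ^ (k + 1) * (p.choose (6 * (k + 1)) : ZMod (p ^ 2))) := fun k hk => by
    have hk := Finset.mem_range.1 hk
    have h1 := natCast_mul_inv_eq_one p (k + 1) (by omega) (by omega)
    have h2 := natCast_mul_choose p (6 * k + 5) (by omega)
    rw [Odd.neg_one_pow ⟨3 * k + 2, by ring⟩, show 6 * k + 5 + 1 = 6 * (k + 1) by ring] at h2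
    push_cast at h1 h2 ⊢
    linear_combination (-1) ^ k *
      (6 * (p.choose (6 * (k + 1)) : ZMod (p ^ 2)) * h1 - ((k : ZMod (p ^ 2)) + 1)⁻¹ * h2)
  rw [Finset.sum_congr rfl this, ← Finset.mul_sum]
  simp
  ring

theorem inv_factorial_eq (p : ℕ) [Fact p.Prime] (k : ℕ) (hk : k + 1 < p) :
    ((k.factorial : ℕ) : ZMod (p ^ 2))⁻¹ =
      (k + 1) * (((k + 1).factorial : ℕ) : ZMod (p ^ 2))⁻¹ := by
  have hp : p.Prime := Fact.out
  have h (j : ℕ) (hj : j < p) :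
      ((j.factorial : ℕ) : ZMod (p ^ 2)) * ((j.factorial : ℕ) : ZMod (p ^ 2))⁻¹ = 1 :=
    ZMod.coe_mul_inv_eq_one _ (Nat.Coprime.pow_right 2
      ((hp.coprime_iff_not_dvd.2 fun h => by have := hp.dvd_factorial.1 h; omega).symm))
  have h1 := h k (by omega)
  have h2 := h (k + 1) hk
  rw [Nat.factorial_succ] at h2 ⊢
  push_cast at h2 ⊢
  linear_combination ((k : ZMod (p ^ 2)) + 1) *
    (((k : ZMod (p ^ 2)) + 1) * (k.factorial : ZMod (p ^ 2)))⁻¹ * h1 -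
    (k.factorial : ZMod (p ^ 2))⁻¹ * h2

theorem truncSum_eq (p : ℕ) [Fact p.Prime] (hp : 3 < p) (m M N : ℕ) (hm : p = 2 * m + 1)
    (hM : (2 * M : ℤ) = p - legendreSym p 3) (hN : (2 * N : ℤ) = p + legendreSym p 3)
    (e : ZMod (p ^ 2)) (he : 6 * e = -(p : ZMod (p ^ 2))) :
    truncSum (fun k => ((k.factorial : ℕ) : ZMod (p ^ 2))⁻¹) m (((p / 6 : ℕ) : ZMod (p ^ 2)) + e) =
      (-1) ^ m * (1 + legendreSym p 3 * seqS (2 * M)) := by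
  have hpp : p.Prime := Fact.out
  have hp3 : p % 3 ≠ 0 := fun h => by
    have := (Nat.prime_dvd_prime_iff_eq Nat.prime_three hpp).1 (Nat.dvd_of_mod_eq_zero h); omega
  have hp2 := natCast_prime_sq_eq_zero p
  have u6 : IsUnit (6 : ZMod (p ^ 2)) := by
    have h2 := natCast_mul_inv_eq_one p 2 (by omega) (by omega)
    have h3 := natCast_mul_inv_eq_one p 3 (by omega) (by omega)
    refine IsUnit.of_mul_eq_one (((2 : ℕ) : ZMod (p ^ 2))⁻¹ * ((3 : ℕ) : ZMod (p ^ 2))⁻¹) ?_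
    push_cast at h2 h3 ⊢
    linear_combination 3 * (3 : ZMod (p ^ 2))⁻¹ * h2 + h3
  have he2 : e ^ 2 = 0 := by
    apply (u6.mul u6).mul_left_cancel
    linear_combination (6 * e - (p : ZMod (p ^ 2))) * he + hp2
  have hpe : (2 * (m : ZMod (p ^ 2)) + 1) * e = 0 := by
    have hmm := congrArg (Nat.cast : ℕ → ZMod (p ^ 2)) hm
    push_cast at hmm
    apply u6.mul_left_cancel
    linear_combination (2 * (m : ZMod (p ^ 2)) + 1) * he - hp2 + p * hmm
  rw [truncSum_nat_add _ (fun k => (k : ZMod (p ^ 2))⁻¹) m (by simp)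
    (fun k hk => inv_factorial_eq p k (by omega))
    (fun k h0 hk => natCast_mul_inv_eq_one p k h0 (by omega)) e he2 hpe (p / 6) (by omega)]
  have hsign : (-1 : ZMod (p ^ 2)) ^ (p / 6) = (-1) ^ m := by
    rw [neg_one_pow_eq_pow_mod_two, neg_one_pow_eq_pow_mod_two (n := m)]
    congr 1
    rcases (by omega : p % 6 = 1 ∨ p % 6 = 5) with h | h <;> omega
  rw [hsign]
  congr 1
  apply u6.mul_left_cancel
  have hH := prime_mul_inv_sum p m hm
  have hA := prime_mul_alternating_inv_sum p
  have h6A := congrArg (Int.cast : ℤ → ZMod (p ^ 2)) (six_mul_sum_choose_eq p hp m N hm hN)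
  have hP := pell_mod_prime_sq p hp m M N hm hM hN
  have h20 : ((2 : ℤ) : ZMod p) ≠ 0 := fun h => by
    have := Nat.le_of_dvd (by norm_num) ((ZMod.natCast_eq_zero_iff 2 p).1 (by exact_mod_cast h))
    omega
  have hleg := congrArg (Int.cast : ℤ → ZMod (p ^ 2)) (legendreSym.sq_one p h20)
  have h2m : (p : ℤ) ∣ 2 ^ m - legendreSym p 2 := by
    rw [← ZMod.intCast_zmod_eq_zero_iff_dvd _ p]
    push_cast
    rw [legendreSym.eq_pow, show p / 2 = m by omega]
    simp
  obtain ⟨c, hc⟩ := h2m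
  replace hc := congrArg (Int.cast : ℤ → ZMod (p ^ 2)) hc
  push_cast at hc h6A hP hleg hH hA ⊢
  -- By Euler's criterion 2^m ≡ (2/p) mod p. The vanishing square trades 2^(p-1) from H_m for the
  -- term (2/p)·2^m of the filter.
  have hsq : ((2 : ZMod (p ^ 2)) ^ m - legendreSym p 2) ^ 2 = 0 := by
    rw [hc]; linear_combination c ^ 2 * hp2
  linear_combination (-(∑ k ∈ Finset.range m, ((k : ZMod (p ^ 2)) + 1)⁻¹) +
    2 * ∑ k ∈ Finset.range (p / 6), (-1) ^ (k + 1) * ((k : ZMod (p ^ 2)) + 1)⁻¹) * he +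
    hH - 2 * hA + 2 * h6A + 2 * hP - 2 * hsq + 2 * hleg

/-! ### Identification of the summands and passage to rationals -/

theorem choose_mul_choose_succ (k : ℕ) :
    (3 * (k + 1)).choose (k + 1) * (6 * (k + 1)).choose (3 * (k + 1)) * (k + 1) ^ 2 =
      12 * (6 * k + 1) * (6 * k + 5) * ((3 * k).choose k * (6 * k).choose (3 * k)) := by
  have h (k : ℕ) : (3 * k).choose k * (6 * k).choose (3 * k) *
      (k.factorial * (2 * k).factorial * (3 * k).factorial) = (6 * k).factorial := by
    have h1 := Nat.choose_mul_factorial_mul_factorial (n := 3 * k) (k := k) (by omega)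
    have h2 := Nat.choose_mul_factorial_mul_factorial (n := 6 * k) (k := 3 * k) (by omega)
    rw [show 3 * k - k = 2 * k by omega] at h1
    rw [show 6 * k - 3 * k = 3 * k by omega] at h2
    rw [← h2, ← h1]
    ring
  have h0 := h k
  have h1 := h (k + 1)
  rw [show 6 * (k + 1) = 6 * k + 1 + 1 + 1 + 1 + 1 + 1 by ring,
    show 3 * (k + 1) = 3 * k + 1 + 1 + 1 by ring] at h1 ⊢
  rw [show 2 * (k + 1) = 2 * k + 1 + 1 by ring] at h1
  simp only [Nat.factorial_succ] at h1
  rw [← h0] at h1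
  have hpos : 0 < 6 * (k + 1) * (2 * k + 1) * (3 * k + 1) * (3 * k + 2) *
      (k.factorial * (2 * k).factorial * (3 * k).factorial) := by positivity
  apply Nat.eq_of_mul_eq_mul_right hpos
  linear_combination h1

/-- Both sides have the same term ratio, as 36(a-k)(-1-a-k) = (6k+1)(6k+5). The map a ↦ -1-a swaps
-1/6 and -5/6, so either value serves. -/
theorem choose_mul_choose_eq {R : Type*} [CommRing R] (h : ℕ → R) (m : ℕ) (h0 : h 0 = 1)
    (hs : ∀ k < m, h k = (k + 1) * h (k + 1)) (hu : ∀ k, 0 < k → k ≤ m → IsUnit (k : R)) (a : R)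
    (ha : 6 * a = -1 ∨ 6 * a = -5) (k : ℕ) (hk : k ≤ m) :
    ((3 * k).choose k : R) * ((6 * k).choose (3 * k) : R) =
      432 ^ k * (h k ^ 2 * fallingProd a k * fallingProd (-1 - a) k) := by
  induction k with
  | zero => simp [h0, fallingProd_zero]
  | succ k ih =>
    have ih' := ih (by omega)
    have hk1 := hs k hk
    have hr := congrArg (Nat.cast : ℕ → R) (choose_mul_choose_succ k)
    have u := hu (k + 1) (by omega) hk
    apply (u.pow 2).mul_right_cancel
    have hq : 36 * ((a - k) * (-1 - a - k)) = (6 * k + 1) * (6 * (k : R) + 5) := by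
      rcases ha with ha | ha
      · linear_combination (-6 * a - 5) * ha
      · linear_combination (-6 * a - 1) * ha
    rw [fallingProd_succ, fallingProd_succ]
    rw [hk1] at ih'
    push_cast at hr ⊢
    rw [hr, ih']
    linear_combination -12 * (432 ^ k * ((((k : R) + 1) * h (k + 1)) ^ 2 * fallingProd a k *
      fallingProd (-1 - a) k)) * hq

theorem ratCongr_div_intCast (p n : ℕ) (hp : p.Prime) (D K V : ℤ) (hD : IsCoprime D p)
    (h : (p : ℤ) ^ n ∣ K - D * V) : RatCongr p n (K / D : ℚ) V := by
  have hden (x : ℤ) : PIntegral p (x / D : ℚ) := fun hx => by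
    have h0 := Rat.den_dvd x D
    rw [Rat.divInt_eq_div] at h0
    have h1 := (Int.natCast_dvd_natCast.2 hx).trans h0
    exact (Nat.prime_iff_prime_int.1 hp).not_isUnit (hD.isUnit_of_dvd' h1 dvd_rfl)
  have hD0 : (D : ℚ) ≠ 0 := fun h0 => by
    rw [Int.cast_eq_zero] at h0
    rw [h0, isCoprime_zero_left] at hD
    exact (Nat.prime_iff_prime_int.1 hp).not_isUnit hD
  obtain ⟨z, hz⟩ := h
  refine ⟨hden K, ?_, z / D, hden z, ?_⟩
  · simpa [PIntegral] using hp.one_lt.ne'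
  · have := congrArg (Int.cast : ℤ → ℚ) hz
    push_cast at this
    field_simp
    linear_combination this

theorem theorem3p3 (p : ℕ) [Fact p.Prime] (hp : 3 < p) :
    RatCongr p 2
      (∑ k ∈ Finset.range ((p - 1) / 2 + 1),
        ((Nat.choose (3 * k) k : ℚ) * (Nat.choose (6 * k) (3 * k) : ℚ)) / (432 : ℚ) ^ k)
      ((-1 : ℚ) ^ ((p - 1) / 2) *
        (1 + (legendreSym p 3 : ℚ) * (seqS ((p : ℤ) - legendreSym p 3).toNat : ℚ))) := by
  have hpp : p.Prime := Fact.out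
  have h2 : p % 2 ≠ 0 := fun h => by
    have := (Nat.prime_dvd_prime_iff_eq Nat.prime_two hpp).1 (Nat.dvd_of_mod_eq_zero h); omega
  have h3 : p % 3 ≠ 0 := fun h => by
    have := (Nat.prime_dvd_prime_iff_eq Nat.prime_three hpp).1 (Nat.dvd_of_mod_eq_zero h); omega
  obtain ⟨m, hm⟩ : ∃ m, p = 2 * m + 1 := ⟨p / 2, by omega⟩
  have hl : legendreSym p 3 = 1 ∨ legendreSym p 3 = -1 := by
    rw [legendreSym_three_eq p hp]; split_ifs <;> simp
  obtain ⟨M, hM⟩ : ∃ M : ℕ, (2 * M : ℤ) = p - legendreSym p 3 := by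
    rcases hl with h | h
    · exact ⟨m, by rw [h]; omega⟩
    · exact ⟨m + 1, by rw [h]; omega⟩
  obtain ⟨N, hN⟩ : ∃ N : ℕ, (2 * N : ℤ) = p + legendreSym p 3 := by
    rcases hl with h | h
    · exact ⟨m + 1, by rw [h]; omega⟩
    · exact ⟨m, by rw [h]; omega⟩
  rw [show (p - 1) / 2 = m by omega, ← hM, show ((2 * M : ℤ)).toNat = 2 * M by omega]
  have hc6 : Nat.Coprime 6 p := by
    refine ((hpp.coprime_iff_not_dvd).2 fun h => ?_).symm
    have h5 : p ∣ 2 * 3 := h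
    rcases hpp.dvd_mul.1 h5 with h | h <;> have := Nat.le_of_dvd (by norm_num) h <;> omega
  have h6 : (6 : ZMod (p ^ 2)) * (6 : ZMod (p ^ 2))⁻¹ = 1 :=
    ZMod.coe_mul_inv_eq_one 6 (hc6.pow_right 2)
  set e : ZMod (p ^ 2) := -(p : ZMod (p ^ 2)) * 6⁻¹ with he
  have he6 : 6 * e = -(p : ZMod (p ^ 2)) := by rw [he]; linear_combination -(p : ZMod (p ^ 2)) * h6
  have hsum := truncSum_eq p hp m M N hm hM hN e he6
  -- 6⌊p/6⌋ is p - 1 or p - 5, and 6e = -p removes the p.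
  have ha : 6 * (((p / 6 : ℕ) : ZMod (p ^ 2)) + e) = -1 ∨
      6 * (((p / 6 : ℕ) : ZMod (p ^ 2)) + e) = -5 := by
    have hr : p % 6 = 1 ∨ p % 6 = 5 := by omega
    have hdm := congrArg (Nat.cast : ℕ → ZMod (p ^ 2)) (Nat.div_add_mod p 6)
    rcases hr with hr | hr <;> rw [hr] at hdm <;> push_cast at hdm
    · left; linear_combination he6 + hdm
    · right; linear_combination he6 + hdm
  have hD : (((432 : ℤ) ^ m : ℤ) : ℚ) ≠ 0 := by positivity
  -- The common denominator 432^m is prime to p, so the claim becomes an integer divisibility by p².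
  have hL : (∑ k ∈ Finset.range (m + 1),
      ((Nat.choose (3 * k) k : ℚ) * (Nat.choose (6 * k) (3 * k) : ℚ)) / (432 : ℚ) ^ k) =
      ((∑ k ∈ Finset.range (m + 1), ((3 * k).choose k : ℤ) * (6 * k).choose (3 * k) *
        432 ^ (m - k) : ℤ) : ℚ) / ((432 ^ m : ℤ) : ℚ) := by
    rw [eq_div_iff hD, Finset.sum_mul]
    push_cast
    refine Finset.sum_congr rfl fun k hk => ?_
    have hk := Finset.mem_range.1 hk
    rw [show (432 : ℚ) ^ m = 432 ^ k * 432 ^ (m - k) by rw [← pow_add]; congr 1; omega]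
    field_simp
  have hR : ((-1 : ℚ) ^ m * (1 + (legendreSym p 3 : ℚ) * (seqS (2 * M) : ℚ))) =
      (((-1) ^ m * (1 + legendreSym p 3 * seqS (2 * M)) : ℤ) : ℚ) := by push_cast; rfl
  rw [hL, hR]
  apply ratCongr_div_intCast p 2 hpp
  · apply IsCoprime.pow_left
    have h1 : IsCoprime (6 : ℤ) p := Nat.isCoprime_iff_coprime.2 hc6
    have h2 : IsCoprime (2 * 3 : ℤ) p := h1
    rw [IsCoprime.mul_left_iff] at h2
    rw [show (432 : ℤ) = 6 ^ 3 * 2 by norm_num]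
    exact h1.pow_left.mul_left h2.1
  · have := (ZMod.intCast_zmod_eq_zero_iff_dvd ((∑ k ∈ Finset.range (m + 1),
      ((3 * k).choose k : ℤ) * (6 * k).choose (3 * k) * 432 ^ (m - k)) -
      432 ^ m * ((-1) ^ m * (1 + legendreSym p 3 * seqS (2 * M)))) (p ^ 2)).1
    push_cast at this
    apply this
    rw [← hsum, truncSum, Finset.mul_sum, sub_eq_zero]
    refine Finset.sum_congr rfl fun k hk => ?_
    have hk := Finset.mem_range.1 hk
    rw [choose_mul_choose_eq (fun k => ((k.factorial : ℕ) : ZMod (p ^ 2))⁻¹) m (by simp)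
      (fun k hk => inv_factorial_eq p k (by omega))
      (fun k h0 hk => IsUnit.of_mul_eq_one _ (natCast_mul_inv_eq_one p k h0 (by omega))) _ ha k
      (by omega), show (432 : ZMod (p ^ 2)) ^ m = 432 ^ k * 432 ^ (m - k) by
        rw [← pow_add]; congr 1; omega]
    ring
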